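/- Let $\mathcal H$ be a reproducing kernel Hilbert space of complex-valued functions on a non-empty set $X$, with kernel $K$. Call $\mathcal H$ irreducible if $K(x,y)\neq 0$ for all $x,y\in X$ and $K(\cdot,x)$, $K(\cdot,y)$ are linearly independent whenever $x\neq y$. Call $\mathcal H$ a complete Nevanlinna–Pick space if for all $s,t,n$, all distinct $z_1,\dots,z_n\in X$ and all complex $s\times t$ matrices $W_1,\dots,W_n$ for which the block matrix $\big((I-W_iW_j^*)K(z_i,z_j)\big)_{i,j=1}^n$ is positive semidefinite, there is a function $\Phi$ from $X$ to the complex $s\times t$ matrices with $\Phi(z_i)=W_i$ for all $i$, pointwise multiplication by which maps $\mathcal H\otimes\mathbb C^t$ contractively into $\mathcal H\otimes\mathbb C^s$. A bounded operator $T$ is hyponormal if $T^*T-TT^*\ge 0$. Let $H^2$ be the Hardy space on the open unit disc $\mathbb D\subset\mathbb C$, that is, the space of power series $\sum_{n\ge 0}a_nz^n$ with norm $(\sum_n|a_n|^2)^{1/2}<\infty$. A set $A\subset\mathbb D$ is a set of uniqueness for $H^2$ if the only element of $H^2$ vanishing on $A$ is $0$. Theorem. Let $\mathcal H$ be an irreducible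 complete Nevanlinna–Pick space on $X$ with kernel $K$ such that every bounded multiplication operator $M_\varphi:f\mapsto\varphi f$ on $\mathcal H$ is hyponormal. Then one of the following holds: (1) $X$ is a singleton $\{x_0\}$ and $\mathcal H=\mathbb C$, that is, $f\mapsto f(x_0)$ is a bijection from $\mathcal H$ onto $\mathbb C$. (2) There are a set of uniqueness $A\subset\mathbb D$ for $H^2$, a bijection $j:X\to A$ and a nowhere vanishing function $\delta:X\to\mathbb C$ such that $$K(\lambda,\mu)=\delta(\lambda)\,\overline{\delta(\mu)}\,\big(1-j(\lambda)\overline{j(\mu)}\big)^{-1}\qquad(\lambda,\mu\in X),$$ and such that moreover: the map $f\mapsto\delta\cdot(f\circ j)$ is a unitary operator from $H^2$ onto $\mathcal H$; for every topology on $X$ for which $K$ is separately continuous on $X\times X$, the map $j$ is continuous; and whenever $X$ is (identified with) a subset of some $\mathbb C^n$ such that $K(\cdot,\mu)$ is holomorphic for every $\mu\in X$, the map $j$ is holomorphic. (A function on a subset of $\mathbb C^n$ is called holomorphic if near each point of the subset it is the restriction of a holomorphic function on an open subset of $\mathbb C^n$; on an open subset this is the usual notion.) -/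

import Mathlib

open scoped ComplexConjugate ComplexOrder Complex.UnitDisc

noncomputable section

namespace HilbertFunctionSpace

section General

variable {X : Type*} (H : Type*) [NormedAddCommGroup H] [InnerProductSpace ℂ H]
  [RKHS ℂ H X ℂ]

/-- The complex-valued reproducing kernel `K(x, y)` of a Hilbert space of complex-valued functions:
`K(·, y)` is the element of `H` with `⟪K(·, y), f⟫ = f y`, and `K(x, y)` is its value at `x`. -/
def kernel [CompleteSpace H] (x y : X) : ℂ := RKHS.kernel H x y 1

/-- Irreducibility: `K` never vanishes, and `K(·, x)`, `K(·, y)` are linearly independent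
whenever `x ≠ y`. -/
def IsIrreducible [CompleteSpace H] : Prop :=
  (∀ x y : X, kernel H x y ≠ 0) ∧
    ∀ x y : X, x ≠ y → LinearIndependent ℂ ![fun u : X => kernel H u x, fun u : X => kernel H u y]

/-- `Φ`, a function on `X` with values in the `s × t` matrices, is a multiplier from `H ⊗ ℂᵗ` to
`H ⊗ ℂˢ` of norm at most `1`: pointwise multiplication by `Φ` maps `Hᵗ` into `Hˢ` contractively. -/
def IsContractiveMultiplier {s t : ℕ} (Φ : X → Matrix (Fin s) (Fin t) ℂ) : Prop :=
  ∀ f : Fin t → H, ∃ g : Fin s → H,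
    (∀ x a, g a x = ∑ b, Φ x a b * f b x) ∧ ∑ a, ‖g a‖ ^ 2 ≤ ∑ b, ‖f b‖ ^ 2

/-- The complete Nevanlinna-Pick property: for all finite families of (distinct) points
`z₁, …, zₙ` and all `s × t` matrices `W₁, …, Wₙ`, positivity of the block matrix
`((I - Wᵢ Wⱼ*) K(zᵢ, zⱼ))` is sufficient for the existence of a contractive multiplier `Φ` with
`Φ(zᵢ) = Wᵢ`. (Necessity holds in every reproducing kernel Hilbert space.) -/
def IsCompleteNevanlinnaPick [CompleteSpace H] : Prop :=
  ∀ (s t n : ℕ) (z : Fin n → X) (W : Fin n → Matrix (Fin s) (Fin t) ℂ), Function.Injective z →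
    (Matrix.of fun p q : Fin n × Fin s =>
      ((1 : Matrix (Fin s) (Fin s) ℂ) - W p.1 * (W q.1).conjTranspose) p.2 q.2 * kernel H (z p.1) (z q.1)).PosSemidef →
    ∃ Φ : X → Matrix (Fin s) (Fin t) ℂ, IsContractiveMultiplier H Φ ∧ ∀ i, Φ (z i) = W i

variable {H} in
/-- `T` is the (bounded) operator of multiplication by `φ` on `H`. -/
def IsMultiplicationOperator (φ : X → ℂ) (T : H →L[ℂ] H) : Prop :=
  ∀ (f : H) (x : X), T f x = φ x * f x

end General

/-- A bounded operator `T` on a Hilbert space is hyponormal if `T* T - T T* ≥ 0`. -/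
def IsHyponormal {H : Type*} [NormedAddCommGroup H] [InnerProductSpace ℂ H] [CompleteSpace H]
    (T : H →L[ℂ] H) : Prop :=
  (ContinuousLinearMap.adjoint T ∘L T - T ∘L ContinuousLinearMap.adjoint T).IsPositive

/-- A function `f` on `X`, where `X` is regarded as a subset of `ℂⁿ` via the injection `e`, is
holomorphic if locally it is the restriction of a holomorphic function defined on an open subset of
`ℂⁿ`. If `X` is open in `ℂⁿ`, then this is the usual notion. -/
def IsHolomorphicVia {X : Type*} {n : ℕ} (e : X → EuclideanSpace ℂ (Fin n)) (f : X → ℂ) : Prop :=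
  ∀ x : X, ∃ (U : Set (EuclideanSpace ℂ (Fin n))) (F : EuclideanSpace ℂ (Fin n) → ℂ),
    IsOpen U ∧ e x ∈ U ∧ DifferentiableOn ℂ F U ∧ ∀ y, e y ∈ U → F (e y) = f y

section Hardy

/-- The Hardy space `H²` of the unit disc: power series with square summable coefficients, normed
by the `ℓ²`-norm of the coefficients. -/
def Hardy : Type := lp (fun _ : ℕ => ℂ) 2

instance : NormedAddCommGroup Hardy := inferInstanceAs (NormedAddCommGroup (lp (fun _ : ℕ => ℂ) 2))

instance : InnerProductSpace ℂ Hardy :=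
  inferInstanceAs (InnerProductSpace ℂ (lp (fun _ : ℕ => ℂ) 2))

instance : CompleteSpace Hardy := inferInstanceAs (CompleteSpace (lp (fun _ : ℕ => ℂ) 2))

/-- The `n`-th Taylor coefficient of `f ∈ H²`. -/
def Hardy.coeff (f : Hardy) (n : ℕ) : ℂ := (show lp (fun _ : ℕ => ℂ) 2 from f) n

/-- The value of `f ∈ H²` at a point of the disc. -/
def Hardy.eval (f : Hardy) (z : 𝔻) : ℂ := ∑' n, f.coeff n * (z : ℂ) ^ n

/-- The element of `H²` with coefficients `conj z ^ n`. -/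
def Hardy.szego (z : 𝔻) : Hardy :=
  show lp (fun _ : ℕ => ℂ) 2 from
    ⟨fun n => conj (z : ℂ) ^ n, by
      refine memℓp_gen ?_
      have h := summable_geometric_of_lt_one (sq_nonneg ‖(z : ℂ)‖)
        (by nlinarith [z.norm_lt_one, norm_nonneg (z : ℂ)])
      refine h.congr fun n => ?_
      simp [← pow_mul, mul_comm]⟩

theorem Hardy.eval_eq_inner (f : Hardy) (z : 𝔻) : f.eval z = inner ℂ (Hardy.szego z) f := by
  refine Eq.trans ?_ (lp.inner_eq_tsum (𝕜 := ℂ) (G := fun _ : ℕ => ℂ) (Hardy.szego z) f).symm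
  refine tsum_congr fun n => ?_
  simp [Hardy.coeff, Hardy.szego]

theorem Hardy.hasSum_eval (f : Hardy) (z : 𝔻) :
    HasSum (fun n => f.coeff n * (z : ℂ) ^ n) (f.eval z) := by
  have h := lp.hasSum_inner (𝕜 := ℂ) (G := fun _ : ℕ => ℂ) (Hardy.szego z) f
  rw [Hardy.eval_eq_inner]
  have e : (fun n => f.coeff n * (z : ℂ) ^ n) =
      fun n => inner ℂ ((show lp (fun _ : ℕ => ℂ) 2 from Hardy.szego z) n) (f.coeff n) := by
    funext n
    simp [Hardy.szego]
  rw [e]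
  exact h

theorem Hardy.eq_zero_of_eval (f : Hardy) (hf : ∀ z, f.eval z = 0) : f = 0 := by
  have hp : HasFPowerSeriesAt (0 : ℂ → ℂ) (FormalMultilinearSeries.ofScalars ℂ f.coeff) 0 := by
    rw [hasFPowerSeriesAt_iff]
    filter_upwards [Metric.ball_mem_nhds (0 : ℂ) one_pos] with z hz
    have h := f.hasSum_eval (Complex.UnitDisc.mk z (by simpa using hz))
    rw [hf] at h
    simpa [mul_comm] using h
  have h0 := hp.eq_zero
  refine lp.ext (E := fun _ : ℕ => ℂ) (p := 2) (funext fun n => ?_)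
  have h1 : f.coeff n = 0 := by
    rw [← FormalMultilinearSeries.coeff_ofScalars (𝕜 := ℂ) (p := f.coeff) (n := n), h0]
    rfl
  exact h1

/-- `H²` as a Hilbert space of functions on the disc, `f(z) = ∑ aₙ zⁿ`. -/
instance : RKHS ℂ Hardy 𝔻 ℂ where
  coeCLM :=
    { toFun := fun f z => f.eval z
      map_add' := fun f g => by ext z; simp only [Hardy.eval_eq_inner, inner_add_right, Pi.add_apply]
      map_smul' := fun c f => by ext z; simp only [Hardy.eval_eq_inner, inner_smul_right]; rfl
      cont := by
        simp only [Hardy.eval_eq_inner]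
        fun_prop }
  coeCLM_injective := fun f g h => by
    refine sub_eq_zero.mp (Hardy.eq_zero_of_eval _ fun z => ?_)
    have hz : f.eval z = g.eval z := congrFun h z
    rw [Hardy.eval_eq_inner] at hz ⊢
    rw [inner_sub_right, hz, Hardy.eval_eq_inner, sub_self]

theorem Hardy.coe_apply (f : Hardy) (z : 𝔻) : f z = ∑' n, f.coeff n * (z : ℂ) ^ n := rfl

/-- The reproducing kernel of `H²` is the Szegő kernel. -/
theorem Hardy.kernel_eq (z w : 𝔻) : kernel Hardy z w = (1 - (z : ℂ) * conj (w : ℂ))⁻¹ := by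
  have h : RKHS.kerFun Hardy w 1 = Hardy.szego w := by
    refine ext_inner_right ℂ fun f => ?_
    rw [RKHS.kerFun_inner, ← Hardy.eval_eq_inner]
    simp [Hardy.coe_apply, Hardy.eval]
  rw [kernel, ← RKHS.kerFun_apply, h, Hardy.coe_apply, ← tsum_geometric_of_norm_lt_one]
  · refine tsum_congr fun n => ?_
    rw [mul_pow, mul_comm]
    rfl
  · rw [norm_mul, RCLike.norm_conj]
    nlinarith [z.norm_lt_one, w.norm_lt_one, norm_nonneg (z : ℂ), norm_nonneg (w : ℂ)]

/-- `A ⊆ 𝔻` is a set of uniqueness for `H²`: only the zero element of `H²` vanishes on `A`. -/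
def IsUniquenessSet (A : Set 𝔻) : Prop :=
  ∀ f : Hardy, (∀ z ∈ A, f z = 0) → f = 0

end Hardy

end HilbertFunctionSpace

end

namespace HilbertFunctionSpace

/-! ### Hyponormal row contractions on a Hilbert space. -/

section Operators

open scoped InnerProduct

variable {H : Type*} [NormedAddCommGroup H] [InnerProductSpace ℂ H] [CompleteSpace H]
  {T S : H →L[ℂ] H} {e : H}

/-! Fix a base point x₀ and let F = 1 - 1/K for the kernel normalized at x₀ (`reducedKernel`). The
aim is to show that F has rank one, F(x,y) = j(x) conj(j(y)): solving for K then gives a rescaled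
Szegő kernel.

The Pick property realizes any factorization of F over finitely many points by a contractive row of
multipliers. With one column this gives extremal functions for the Schwarz lemma at x₀. A hyponormal
extremal multiplier is isometric at e = K(·,x₀)
(`IsMultiplicationOperator.adjoint_apply_kernelVec`).

If |F(z,y)|² < F(y,y) F(z,z) for some y, z, a two-column row (T, S) over x₀, y, z has both entries
isometric at e. Hyponormality makes T and S isometric along their orbits of e, and the row
inequality makes suitable vectors orthogonal. Rotating the row by π/4 preserves all this. With ‖e‖ =
1, comparing the two rows forces ‖TSe‖² = 1/2 and ‖T²S²e‖² = 1/6, whereas hyponormality of TS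
requires ‖TSe‖² ≤ ‖T²S²e‖ (`IsHyponormalRow.eq_zero`). So Cauchy–Schwarz for F is an equality
(`norm_reducedKernel`), and one extremal function j is extremal at every point (`exists_rank_one`).

Multiplication by j is isometric along the orbit of e, and the powers of j times e/‖e‖ form an
orthonormal basis, which identifies the space with H² (`exists_hardy_equiv`). -/

theorem IsHyponormal.norm_adjoint_apply_le (hT : IsHyponormal T) (f : H) : ‖(T†) f‖ ≤ ‖T f‖ := by
  have h := hT.re_inner_nonneg_left f
  have h1 : inner ℂ ((T†) (T f)) f = inner ℂ (T f) (T f) := ContinuousLinearMap.adjoint_inner_left ..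
  have h2 : inner ℂ (T ((T†) f)) f = inner ℂ ((T†) f) ((T†) f) :=
    (ContinuousLinearMap.adjoint_inner_right ..).symm
  simp only [FunLike.coe_sub, ContinuousLinearMap.coe_comp, Pi.sub_apply,
    Function.comp_apply, inner_sub_left, h1, h2, map_sub, inner_self_eq_norm_sq] at h
  exact (sq_le_sq₀ (norm_nonneg _) (norm_nonneg _)).mp (by linarith)

theorem norm_adjoint_apply_le_of_contraction (hT : ∀ f, ‖T f‖ ≤ ‖f‖) (f : H) : ‖(T†) f‖ ≤ ‖f‖ := by
  have h : ‖T‖ ≤ 1 := T.opNorm_le_bound zero_le_one (by simpa using hT)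
  refine (T†).le_of_opNorm_le (c := 1) ?_ f |>.trans (by simp)
  rwa [LinearIsometryEquiv.norm_map]

/-- A contraction which preserves the norm of `h` is isometric at `h`. -/
theorem adjoint_apply_apply_eq_self (hT : ∀ f, ‖T f‖ ≤ ‖f‖) {h : H} (hh : ‖h‖ ≤ ‖T h‖) :
    (T†) (T h) = h := by
  have h1 : ‖(T†) (T h)‖ ^ 2 ≤ ‖h‖ ^ 2 := by
    gcongr
    exact (norm_adjoint_apply_le_of_contraction hT _).trans (hT h)
  have h2 : RCLike.re (inner ℂ ((T†) (T h)) h) = ‖T h‖ ^ 2 := by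
    rw [ContinuousLinearMap.adjoint_inner_left, inner_self_eq_norm_sq]
  -- Expanding ‖T*Th - h‖² gives at most ‖h‖² - 2‖Th‖² + ‖h‖², which is not positive.
  have h3 := norm_sub_sq (𝕜 := ℂ) ((T†) (T h)) h
  have h4 : ‖h‖ ^ 2 ≤ ‖T h‖ ^ 2 := by gcongr
  rw [h2] at h3
  have h5 : ‖(T†) (T h) - h‖ ^ 2 ≤ 0 := by linarith
  exact sub_eq_zero.mp (norm_eq_zero.mp (pow_eq_zero_iff two_ne_zero |>.mp
    (le_antisymm h5 (sq_nonneg _))))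

theorem norm_apply_of_adjoint_apply_apply {h : H} (hh : (T†) (T h) = h) : ‖T h‖ = ‖h‖ := by
  have h1 : inner ℂ (T h) (T h) = inner ℂ h h := by
    rw [← ContinuousLinearMap.adjoint_inner_left, hh]
  have h2 := congrArg RCLike.re h1
  rw [inner_self_eq_norm_sq, inner_self_eq_norm_sq] at h2
  exact (sq_eq_sq₀ (norm_nonneg _) (norm_nonneg _)).mp h2

/-- The space on which a hyponormal contraction is isometric is invariant. -/
theorem IsHyponormal.adjoint_apply_apply_apply (hT : IsHyponormal T) (hc : ∀ f, ‖T f‖ ≤ ‖f‖)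
    {h : H} (hh : (T†) (T h) = h) : (T†) (T (T h)) = T h := by
  refine adjoint_apply_apply_eq_self hc ?_
  rw [norm_apply_of_adjoint_apply_apply hh]
  -- Since h = T*Th, hyponormality at Th gives ‖h‖ = ‖T*(Th)‖ ≤ ‖T(Th)‖.
  conv_lhs => rw [← hh]
  exact hT.norm_adjoint_apply_le _

theorem IsHyponormal.adjoint_apply_pow (hT : IsHyponormal T) (hc : ∀ f, ‖T f‖ ≤ ‖f‖)
    (he : (T†) (T e) = e) (n : ℕ) : (T†) ((T ^ (n + 1)) e) = (T ^ n) e := by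
  induction n with
  | zero => simpa using he
  | succ n ih =>
    rw [pow_succ' T n, pow_succ' T (n + 1), pow_succ' T n] at *
    exact hT.adjoint_apply_apply_apply hc ih

/-- A commuting hyponormal row contraction `(T, S)` both entries of which are isometric at `e`. -/
structure IsHyponormalRow (T S : H →L[ℂ] H) (e : H) : Prop where
  comm : ∀ f, T (S f) = S (T f)
  left : IsHyponormal T
  right : IsHyponormal S
  row : ∀ f g, ‖T f + S g‖ ^ 2 ≤ ‖f‖ ^ 2 + ‖g‖ ^ 2
  left_apply : (T†) (T e) = e
  right_apply : (S†) (S e) = e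

/-- The entries of a row contraction have orthogonal ranges wherever one of them is isometric. -/
theorem adjoint_apply_eq_zero_of_row (row : ∀ f g, ‖T f + S g‖ ^ 2 ≤ ‖f‖ ^ 2 + ‖g‖ ^ 2)
    {h : H} (hh : (T†) (T h) = h) : (S†) (T h) = 0 := by
  -- For the test pair (h, S*Th), the cross term 2‖S*Th‖² on the left exceeds the ‖S*Th‖² allowed on
  -- the right unless S*Th = 0.
  have h1 := row h ((S†) (T h))
  rw [norm_add_sq (𝕜 := ℂ), ← ContinuousLinearMap.adjoint_inner_left, inner_self_eq_norm_sq,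
    norm_apply_of_adjoint_apply_apply hh] at h1
  have h2 : ‖(S†) (T h)‖ ^ 2 ≤ 0 := by nlinarith [sq_nonneg ‖S ((S†) (T h))‖]
  exact norm_eq_zero.mp (pow_eq_zero_iff two_ne_zero |>.mp (le_antisymm h2 (sq_nonneg _)))

namespace IsHyponormalRow

theorem symm (h : IsHyponormalRow T S e) : IsHyponormalRow S T e where
  comm f := (h.comm f).symm
  left := h.right
  right := h.left
  row f g := by rw [add_comm, add_comm (‖f‖ ^ 2)]; exact h.row g f
  left_apply := h.right_apply
  right_apply := h.left_apply

theorem norm_left_le (h : IsHyponormalRow T S e) (f : H) : ‖T f‖ ≤ ‖f‖ := by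
  have := h.row f 0
  simp only [map_zero, add_zero, norm_zero, ne_eq, OfNat.ofNat_ne_zero, not_false_eq_true,
    zero_pow] at this
  exact (sq_le_sq₀ (norm_nonneg _) (norm_nonneg _)).mp this

theorem norm_apply_apply (h : IsHyponormalRow T S e) : ‖T (T e)‖ = ‖e‖ := by
  have h1 := h.left.adjoint_apply_apply_apply h.norm_left_le h.left_apply
  rw [norm_apply_of_adjoint_apply_apply h1, norm_apply_of_adjoint_apply_apply h.left_apply]

theorem inner_apply_apply (h : IsHyponormalRow T S e) (g : H) : inner ℂ (T (T e)) (S g) = 0 := by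
  have h1 := h.left.adjoint_apply_apply_apply h.norm_left_le h.left_apply
  rw [← ContinuousLinearMap.adjoint_inner_left, adjoint_apply_eq_zero_of_row h.row h1,
    inner_zero_left]

theorem norm_apply_four (h : IsHyponormalRow T S e) : ‖T (T (T (T e)))‖ = ‖e‖ := by
  have h1 := h.left.adjoint_apply_apply_apply h.norm_left_le h.left_apply
  have h2 := h.left.adjoint_apply_apply_apply h.norm_left_le h1
  have h3 := h.left.adjoint_apply_apply_apply h.norm_left_le h2
  rw [norm_apply_of_adjoint_apply_apply h3, norm_apply_of_adjoint_apply_apply h2,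
    h.norm_apply_apply]

theorem inner_apply_four (h : IsHyponormalRow T S e) (g : H) :
    inner ℂ (T (T (T (T e)))) (S g) = 0 := by
  have h1 := h.left.adjoint_apply_apply_apply h.norm_left_le h.left_apply
  have h2 := h.left.adjoint_apply_apply_apply h.norm_left_le h1
  have h3 := h.left.adjoint_apply_apply_apply h.norm_left_le h2
  rw [← ContinuousLinearMap.adjoint_inner_left, adjoint_apply_eq_zero_of_row h.row h3,
    inner_zero_left]

theorem inner_left_right (h : IsHyponormalRow T S e) : inner ℂ (T e) (S e) = 0 := by
  rw [← ContinuousLinearMap.adjoint_inner_left, adjoint_apply_eq_zero_of_row h.row h.left_apply,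
    inner_zero_left]

/-- Rotation of a hyponormal row by `π / 4`. -/
theorem rotate (h : IsHyponormalRow T S e) {r : ℂ} (hr : ‖r‖ ^ 2 = 1 / 2)
    (hadd : IsHyponormal (r • (T + S))) (hsub : IsHyponormal (r • (T - S))) :
    IsHyponormalRow (r • (T + S)) (r • (T - S)) e := by
  have row : ∀ f g, ‖(r • (T + S)) f + (r • (T - S)) g‖ ^ 2 ≤ ‖f‖ ^ 2 + ‖g‖ ^ 2 := by
    intro f g
    have h1 : (r • (T + S)) f + (r • (T - S)) g = r • (T (f + g) + S (f - g)) := by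
      simp only [FunLike.coe_smul, FunLike.coe_add, FunLike.coe_sub, Pi.smul_apply,
        Pi.add_apply, Pi.sub_apply, map_add, map_sub]
      module
    have h2 := h.row (f + g) (f - g)
    -- The change of variables (f, g) ↦ (f + g, f - g) is unitary up to the factor √2, which r
    -- absorbs.
    have h3 := parallelogram_law_with_norm ℂ f g
    rw [h1, norm_smul, mul_pow, hr]
    linarith
  have hT := norm_apply_of_adjoint_apply_apply h.left_apply
  have hS := norm_apply_of_adjoint_apply_apply h.right_apply
  have hadd' : ‖(r • (T + S)) e‖ ^ 2 = ‖e‖ ^ 2 := by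
    simp only [FunLike.coe_smul, FunLike.coe_add, Pi.smul_apply, Pi.add_apply]
    rw [norm_smul, mul_pow, hr, norm_add_sq (𝕜 := ℂ), h.inner_left_right, hT, hS, map_zero]
    ring
  have hsub' : ‖(r • (T - S)) e‖ ^ 2 = ‖e‖ ^ 2 := by
    simp only [FunLike.coe_smul, FunLike.coe_sub, Pi.smul_apply, Pi.sub_apply]
    rw [norm_smul, mul_pow, hr, norm_sub_sq (𝕜 := ℂ), h.inner_left_right, hT, hS, map_zero]
    ring
  refine ⟨fun f => ?_, hadd, hsub, row, ?_, ?_⟩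
  · simp only [FunLike.coe_smul, FunLike.coe_add, FunLike.coe_sub, Pi.smul_apply,
        Pi.add_apply, Pi.sub_apply, map_add, map_sub, map_smul, h.comm]
    module
  · refine adjoint_apply_apply_eq_self (fun f => ?_) ?_
    · have := row f 0
      simp only [map_zero, add_zero, norm_zero, ne_eq, OfNat.ofNat_ne_zero, not_false_eq_true,
        zero_pow] at this
      exact (sq_le_sq₀ (norm_nonneg _) (norm_nonneg _)).mp this
    · exact ((sq_eq_sq₀ (norm_nonneg _) (norm_nonneg _)).mp hadd').ge
  · refine adjoint_apply_apply_eq_self (fun f => ?_) ?_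
    · have := row 0 f
      simp only [map_zero, zero_add, norm_zero, ne_eq, OfNat.ofNat_ne_zero, not_false_eq_true,
        zero_pow] at this
      exact (sq_le_sq₀ (norm_nonneg _) (norm_nonneg _)).mp this
    · exact ((sq_eq_sq₀ (norm_nonneg _) (norm_nonneg _)).mp hsub').ge

/-- By commutativity the rotated product is r²(T² - S²), and T²e, S²e are orthogonal vectors of norm
‖e‖. -/
theorem norm_rotate_sq (h : IsHyponormalRow T S e) {r : ℂ} (hr : ‖r‖ ^ 2 = 1 / 2) :
    ‖(r • (T + S)) ((r • (T - S)) e)‖ ^ 2 = ‖e‖ ^ 2 / 2 := by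
  have h1 : (r • (T + S)) ((r • (T - S)) e) = (r ^ 2) • (T (T e) - S (S e)) := by
    simp only [FunLike.coe_smul, FunLike.coe_add, FunLike.coe_sub, Pi.smul_apply,
      Pi.add_apply, Pi.sub_apply, map_sub, map_smul, h.comm]
    module
  rw [h1, norm_smul, mul_pow, norm_pow, hr, norm_sub_sq (𝕜 := ℂ), h.inner_apply_apply,
    h.norm_apply_apply, h.symm.norm_apply_apply, map_zero]
  ring

/-- Expand r⁴(T² - S²)². The vectors T⁴e and S⁴e are orthogonal to the range of the other operator,
so no cross term survives and ‖T²S²e‖ is the only unknown. -/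
theorem norm_rotate_rotate_sq (h : IsHyponormalRow T S e) {r : ℂ} (hr : ‖r‖ ^ 2 = 1 / 2) :
    ‖(r • (T + S)) ((r • (T + S)) ((r • (T - S)) ((r • (T - S)) e)))‖ ^ 2 =
      (2 * ‖e‖ ^ 2 + 4 * ‖T (T (S (S e)))‖ ^ 2) / 16 := by
  have h1 : (r • (T + S)) ((r • (T + S)) ((r • (T - S)) ((r • (T - S)) e))) =
      (r ^ 4) • ((T (T (T (T e))) + S (S (S (S e)))) - (2 : ℂ) • T (T (S (S e)))) := by
    simp only [FunLike.coe_smul, FunLike.coe_add, FunLike.coe_sub, Pi.smul_apply,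
      Pi.add_apply, Pi.sub_apply, map_sub, map_add, map_smul, h.comm]
    module
  have h2 : inner ℂ (T (T (T (T e)))) (T (T (S (S e)))) = 0 := by
    rw [h.comm, h.comm]; exact h.inner_apply_four _
  have h3 : inner ℂ (S (S (S (S e)))) (T (T (S (S e)))) = 0 := h.symm.inner_apply_four _
  have hr4 : ‖r‖ ^ 4 = 1 / 4 := by
    rw [show 4 = 2 * 2 from rfl, pow_mul, hr]; norm_num
  rw [h1, norm_smul, mul_pow, norm_pow, hr4, norm_sub_sq (𝕜 := ℂ), norm_add_sq (𝕜 := ℂ),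
    inner_add_left, inner_smul_right, inner_smul_right, h2, h3, h.inner_apply_four,
    h.norm_apply_four, h.symm.norm_apply_four, norm_smul, mul_pow]
  norm_num
  ring

/-- Commuting operators which generate hyponormal polynomials cannot form a row contraction that is
isometric, in both entries, at a nonzero vector. -/
theorem eq_zero (h : IsHyponormalRow T S e) (hadd : ∀ r : ℂ, IsHyponormal (r • (T + S)))
    (hsub : ∀ r : ℂ, IsHyponormal (r • (T - S))) (hmul : IsHyponormal (T ∘L S)) : e = 0 := by
  -- A real r makes the rotation an involution, so that rotating twice returns (T, S).
  obtain ⟨r, hr, hr'⟩ : ∃ r : ℂ, ‖r‖ ^ 2 = 1 / 2 ∧ r ^ 2 = 1 / 2 := by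
    refine ⟨(Real.sqrt (1 / 2) : ℝ), ?_, ?_⟩
    · rw [Complex.norm_real, Real.norm_of_nonneg (Real.sqrt_nonneg _), Real.sq_sqrt (by norm_num)]
    · rw [← Complex.ofReal_pow, Real.sq_sqrt (by norm_num)]
      norm_num
  have h' := h.rotate hr (hadd r) (hsub r)
  have hT : r • (r • (T + S) + r • (T - S)) = T := by
    have : r • (r • (T + S) + r • (T - S)) = (2 * r ^ 2) • T := by module
    rw [this, hr']
    norm_num
  have hS : r • (r • (T + S) - r • (T - S)) = S := by
    have : r • (r • (T + S) - r • (T - S)) = (2 * r ^ 2) • S := by module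
    rw [this, hr']
    norm_num
  have h1 := h.norm_rotate_rotate_sq hr
  have h2 := h'.norm_rotate_rotate_sq hr
  have h3 := h'.norm_rotate_sq hr
  rw [hT, hS] at h2 h3
  have h4 : ‖T (S e)‖ ^ 2 ≤ ‖T (T (S (S e)))‖ * ‖e‖ := by
    have h5 : ‖T (S e)‖ ^ 2 = RCLike.re (inner ℂ (((T ∘L S)†) (T (S e))) e) := by
      rw [ContinuousLinearMap.adjoint_inner_left, ContinuousLinearMap.comp_apply,
        inner_self_eq_norm_sq]
    have h6 : ‖((T ∘L S)†) (T (S e))‖ ≤ ‖T (T (S (S e)))‖ := by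
      refine (hmul.norm_adjoint_apply_le _).trans_eq ?_
      rw [ContinuousLinearMap.comp_apply, ← h.comm (S e)]
    rw [h5]
    exact (re_inner_le_norm _ _).trans (by gcongr)
  rw [h3] at h4
  -- Let q and q' be the values of ‖T²S²e‖² for the row and its rotation. Then q' = (2‖e‖² + 4q)/16,
  -- and the same with q and q' exchanged, whence q = q' = ‖e‖²/6.
  have h7 : ‖T (T (S (S e)))‖ ^ 2 = ‖e‖ ^ 2 / 6 := by linarith
  by_contra he
  have h8 : 0 < ‖e‖ := norm_pos_iff.mpr he
  have h9 : ‖e‖ / 2 ≤ ‖T (T (S (S e)))‖ := by nlinarith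
  nlinarith

end IsHyponormalRow

end Operators

/-! ### Multipliers, the reduced kernel and Pick interpolation. -/

section Pick

open scoped InnerProduct

variable {X H : Type*} [NormedAddCommGroup H] [InnerProductSpace ℂ H] [RKHS ℂ H X ℂ]

namespace IsMultiplicationOperator

variable {φ ψ : X → ℂ} {T S : H →L[ℂ] H}

theorem add (hT : IsMultiplicationOperator φ T) (hS : IsMultiplicationOperator ψ S) :
    IsMultiplicationOperator (φ + ψ) (T + S) := fun f x => by
  simp [hT f x, hS f x, add_mul]

theorem sub (hT : IsMultiplicationOperator φ T) (hS : IsMultiplicationOperator ψ S) :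
    IsMultiplicationOperator (φ - ψ) (T - S) := fun f x => by
  simp [hT f x, hS f x, sub_mul]

theorem smul (c : ℂ) (hT : IsMultiplicationOperator φ T) :
    IsMultiplicationOperator (c • φ) (c • T) := fun f x => by
  simp [hT f x, mul_assoc]

theorem comp (hT : IsMultiplicationOperator φ T) (hS : IsMultiplicationOperator ψ S) :
    IsMultiplicationOperator (φ * ψ) (T ∘L S) := fun f x => by
  simp [hT _ x, hS f x, mul_assoc]

theorem pow_apply (hT : IsMultiplicationOperator φ T) (n : ℕ) (f : H) (x : X) :
    (T ^ n) f x = φ x ^ n * f x := by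
  induction n with
  | zero => simp
  | succ n ih => rw [pow_succ', mul_apply_eq_comp, hT, ih, pow_succ']; ring

end IsMultiplicationOperator

variable [CompleteSpace H]

variable (H) in
/-- The reproducing kernel function `K(·, x)`. -/
noncomputable def kernelVec (x : X) : H := RKHS.kerFun H x (1 : ℂ)

theorem inner_kernelVec_left (x : X) (f : H) : inner ℂ (kernelVec H x) f = f x := by
  simp [kernelVec]

theorem kernelVec_apply (x y : X) : kernelVec H y x = kernel H x y := RKHS.kerFun_apply ..

theorem conj_kernel (x y : X) : conj (kernel H x y) = kernel H y x := by
  rw [← kernelVec_apply, ← kernelVec_apply, ← inner_kernelVec_left, inner_conj_symm,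
    inner_kernelVec_left]

theorem kernel_self (x : X) : kernel H x x = (‖kernelVec H x‖ : ℂ) ^ 2 := by
  rw [← kernelVec_apply, ← inner_kernelVec_left, inner_self_eq_norm_sq_to_K]
  rfl

theorem norm_kernelVec_pos (hirr : IsIrreducible (X := X) H) (x : X) : 0 < ‖kernelVec H x‖ := by
  refine lt_of_le_of_ne (norm_nonneg _) fun h => hirr.1 x x ?_
  rw [kernel_self, ← h]
  simp

theorem IsMultiplicationOperator.adjoint_kernelVec {φ : X → ℂ} {T : H →L[ℂ] H}
    (hT : IsMultiplicationOperator φ T) (x : X) :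
    (T†) (kernelVec H x) = conj (φ x) • kernelVec H x := by
  refine ext_inner_right ℂ fun f => ?_
  rw [ContinuousLinearMap.adjoint_inner_left, inner_kernelVec_left, hT, inner_smul_left,
    inner_kernelVec_left, Complex.conj_conj]

variable (H) in
/-- The kernel `1 - K(x, x₀) K(x₀, y) / (K(x₀, x₀) K(x, y))`, that is, `1 - 1 / K` for the kernel
normalized at `x₀`. -/
noncomputable def reducedKernel (x₀ x y : X) : ℂ :=
  1 - kernel H x x₀ * kernel H x₀ y / (kernel H x₀ x₀ * kernel H x y)

theorem conj_reducedKernel (x₀ x y : X) :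
    conj (reducedKernel H x₀ x y) = reducedKernel H x₀ y x := by
  simp only [reducedKernel, map_sub, map_one, map_div₀, map_mul, conj_kernel]
  ring

theorem reducedKernel_mul (hirr : IsIrreducible (X := X) H) (x₀ x y : X) :
    reducedKernel H x₀ x y * kernel H x y =
      kernel H x y - kernel H x x₀ * kernel H x₀ y / kernel H x₀ x₀ := by
  have := hirr.1 x y
  have := hirr.1 x₀ x₀
  rw [reducedKernel]
  field_simp

theorem reducedKernel_left (hirr : IsIrreducible (X := X) H) (x₀ y : X) :
    reducedKernel H x₀ x₀ y = 0 := by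
  rw [reducedKernel, div_self (mul_ne_zero (hirr.1 _ _) (hirr.1 _ _)), sub_self]

theorem reducedKernel_right (hirr : IsIrreducible (X := X) H) (x₀ x : X) :
    reducedKernel H x₀ x x₀ = 0 := by
  rw [← conj_reducedKernel, reducedKernel_left hirr, map_zero]

variable (H) in
/-- The component of `K(·, y)` orthogonal to `K(·, x₀)`. -/
noncomputable def reducedVec (x₀ y : X) : H :=
  kernelVec H y - (kernel H x₀ y / kernel H x₀ x₀) • kernelVec H x₀

theorem reducedVec_apply (hirr : IsIrreducible (X := X) H) (x₀ x y : X) :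
    reducedVec H x₀ y x = reducedKernel H x₀ x y * kernel H x y := by
  rw [reducedKernel_mul hirr]
  simp only [reducedVec, RKHS.coe_sub, RKHS.coe_smul, Pi.sub_apply, Pi.smul_apply, kernelVec_apply,
    smul_eq_mul]
  ring

variable (H) in
/-- The pseudo-hyperbolic distance of `x₀` and `y`. -/
noncomputable def radius (x₀ y : X) : ℝ := ‖reducedVec H x₀ y‖ / ‖kernelVec H y‖

theorem norm_reducedVec (hirr : IsIrreducible (X := X) H) (x₀ y : X) :
    ‖reducedVec H x₀ y‖ = radius H x₀ y * ‖kernelVec H y‖ := by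
  rw [radius, div_mul_cancel₀ _ (norm_kernelVec_pos hirr y).ne']

/-- `reducedVec H x₀ y` vanishes at x₀, so its squared norm is its value at y. -/
theorem reducedKernel_self (hirr : IsIrreducible (X := X) H) (x₀ y : X) :
    reducedKernel H x₀ y y = (radius H x₀ y : ℂ) ^ 2 := by
  have h : inner ℂ (reducedVec H x₀ y) (reducedVec H x₀ y) =
      reducedKernel H x₀ y y * kernel H y y := by
    nth_rewrite 1 [reducedVec]
    rw [inner_sub_left, inner_smul_left, inner_kernelVec_left, inner_kernelVec_left,
      reducedVec_apply hirr, reducedVec_apply hirr, reducedKernel_left hirr]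
    ring
  rw [inner_self_eq_norm_sq_to_K, norm_reducedVec hirr, kernel_self] at h
  have h0 : (‖kernelVec H y‖ : ℂ) ≠ 0 := by exact_mod_cast (norm_kernelVec_pos hirr y).ne'
  push_cast [mul_pow] at h
  exact (mul_right_cancel₀ (pow_ne_zero 2 h0) h).symm

theorem radius_pos (hirr : IsIrreducible (X := X) H) {x₀ y : X} (hy : y ≠ x₀) :
    0 < radius H x₀ y := by
  refine div_pos (norm_pos_iff.mpr fun h => ?_) (norm_kernelVec_pos hirr y)
  have h1 := LinearIndependent.pair_iff.mp (hirr.2 y x₀ hy) 1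
    (-(kernel H x₀ y / kernel H x₀ x₀)) ?_
  · exact one_ne_zero h1.1
  · funext u
    have h2 := congrArg (fun f : H => f u) h
    simp only [reducedVec, RKHS.coe_sub, RKHS.coe_smul, Pi.sub_apply, Pi.smul_apply,
      kernelVec_apply, RKHS.coe_zero, Pi.zero_apply, smul_eq_mul] at h2
    simp only [Pi.add_apply, Pi.smul_apply, smul_eq_mul, Pi.zero_apply]
    linear_combination h2

/-- The defect 1 - radius² is the squared modulus of the normalized value K(x₀, y), which is nonzero
by irreducibility. -/
theorem radius_lt_one (hirr : IsIrreducible (X := X) H) (x₀ y : X) : radius H x₀ y < 1 := by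
  have h1 := reducedKernel_self hirr x₀ y
  have h2 : kernel H y x₀ * kernel H x₀ y = (‖kernel H x₀ y‖ : ℂ) ^ 2 := by
    rw [← conj_kernel x₀ y, Complex.conj_mul']
  rw [reducedKernel, h2, kernel_self, kernel_self] at h1
  have h3 : radius H x₀ y ^ 2 =
      1 - ‖kernel H x₀ y‖ ^ 2 / (‖kernelVec H x₀‖ ^ 2 * ‖kernelVec H y‖ ^ 2) := by
    exact_mod_cast h1.symm
  have h4 : 0 < ‖kernel H x₀ y‖ ^ 2 / (‖kernelVec H x₀‖ ^ 2 * ‖kernelVec H y‖ ^ 2) := by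
    have := norm_kernelVec_pos hirr x₀
    have := norm_kernelVec_pos hirr y
    have := norm_pos_iff.mpr (hirr.1 x₀ y)
    positivity
  nlinarith

/-! ### The Schwarz lemma and its extremal functions. -/

section Extremal

variable {φ : X → ℂ} {T : H →L[ℂ] H} {x₀ y : X}

theorem IsMultiplicationOperator.adjoint_reducedVec (hT : IsMultiplicationOperator φ T)
    (h0 : φ x₀ = 0) : (T†) (reducedVec H x₀ y) = conj (φ y) • kernelVec H y := by
  simp [reducedVec, hT.adjoint_kernelVec, h0]

/-- The Schwarz lemma: a contractive multiplier vanishing at `x₀` is bounded by the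
pseudo-hyperbolic distance to `x₀`. -/
theorem IsMultiplicationOperator.norm_le_radius (hirr : IsIrreducible (X := X) H)
    (hT : IsMultiplicationOperator φ T) (hc : ∀ f, ‖T f‖ ≤ ‖f‖) (h0 : φ x₀ = 0) (y : X) :
    ‖φ y‖ ≤ radius H x₀ y := by
  have h2 := norm_adjoint_apply_le_of_contraction hc (reducedVec H x₀ y)
  rw [hT.adjoint_reducedVec h0, norm_smul, RCLike.norm_conj, norm_reducedVec hirr] at h2
  exact le_of_mul_le_mul_right h2 (norm_kernelVec_pos hirr y)

theorem IsMultiplicationOperator.norm_adjoint_reducedVec (hirr : IsIrreducible (X := X) H)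
    (hT : IsMultiplicationOperator φ T) (h0 : φ x₀ = 0) (hy : ‖φ y‖ = radius H x₀ y) :
    ‖(T†) (reducedVec H x₀ y)‖ = ‖reducedVec H x₀ y‖ := by
  rw [hT.adjoint_reducedVec h0, norm_smul, RCLike.norm_conj, hy, norm_reducedVec hirr]

/-- Equality in the Schwarz lemma determines the action of the multiplier on `K(·, y)`. -/
theorem IsMultiplicationOperator.conj_smul_apply_kernelVec (hirr : IsIrreducible (X := X) H)
    (hT : IsMultiplicationOperator φ T) (hc : ∀ f, ‖T f‖ ≤ ‖f‖)
    (h0 : φ x₀ = 0) (hy : ‖φ y‖ = radius H x₀ y) :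
    conj (φ y) • T (kernelVec H y) = reducedVec H x₀ y := by
  -- Equality means that T* preserves the norm of `reducedVec`, hence TT* fixes it.
  have h1 := adjoint_apply_apply_eq_self (T := T†) (norm_adjoint_apply_le_of_contraction hc)
    (hT.norm_adjoint_reducedVec hirr h0 hy).ge
  rwa [ContinuousLinearMap.adjoint_adjoint, hT.adjoint_reducedVec h0, map_smul] at h1

/-- Extremal functions of the Schwarz lemma are unique up to a unimodular factor. -/
theorem IsMultiplicationOperator.mul_conj_eq_reducedKernel (hirr : IsIrreducible (X := X) H)
    (hT : IsMultiplicationOperator φ T) (hc : ∀ f, ‖T f‖ ≤ ‖f‖)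
    (h0 : φ x₀ = 0) (hy : ‖φ y‖ = radius H x₀ y) (x : X) :
    φ x * conj (φ y) = reducedKernel H x₀ x y := by
  have h1 := congrArg (fun f : H => f x) (hT.conj_smul_apply_kernelVec hirr hc h0 hy)
  simp only [RKHS.coe_smul, Pi.smul_apply, hT _ x, kernelVec_apply, reducedVec_apply hirr,
    smul_eq_mul] at h1
  refine mul_right_cancel₀ (hirr.1 x y) ?_
  rw [← h1]
  ring

/-- A hyponormal extremal multiplier of the Schwarz lemma is isometric at `K(·, x₀)`. -/
theorem IsMultiplicationOperator.adjoint_apply_kernelVec (hirr : IsIrreducible (X := X) H)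
    (hT : IsMultiplicationOperator φ T) (hc : ∀ f, ‖T f‖ ≤ ‖f‖) (hhyp : IsHyponormal T)
    (h0 : φ x₀ = 0) (hne : y ≠ x₀) (hy : ‖φ y‖ = radius H x₀ y) :
    (T†) (T (kernelVec H x₀)) = kernelVec H x₀ := by
  have hφ : conj (φ y) ≠ 0 := by
    rw [ne_eq, map_eq_zero, ← norm_eq_zero, hy]
    exact (radius_pos hirr hne).ne'
  have h1 := hT.conj_smul_apply_kernelVec hirr hc h0 hy
  have h2 : (T†) (T (kernelVec H y)) = kernelVec H y := by
    refine smul_right_injective H hφ ?_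
    simp only
    rw [← map_smul, h1, hT.adjoint_reducedVec h0]
  have h3 : (T†) (T (reducedVec H x₀ y)) = reducedVec H x₀ y :=
    adjoint_apply_apply_eq_self hc ((hT.norm_adjoint_reducedVec hirr h0 hy).ge.trans
      (hhyp.norm_adjoint_apply_le _))
  -- T*T fixes K(·, y) and its component orthogonal to K(·, x₀), hence also their difference, a
  -- nonzero multiple of K(·, x₀).
  have h4 : kernel H x₀ y / kernel H x₀ x₀ ≠ 0 := div_ne_zero (hirr.1 _ _) (hirr.1 _ _)
  refine smul_right_injective H h4 ?_
  simp only [reducedVec, map_sub, map_smul, h2] at h3 ⊢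
  exact sub_right_injective h3

end Extremal

/-- A solvable Pick problem for row-valued functions. -/
theorem IsCompleteNevanlinnaPick.exists_row (hirr : IsIrreducible (X := X) H)
    (hnp : IsCompleteNevanlinnaPick (X := X) H) (x₀ : X) {n t : ℕ} {z : Fin n → X}
    (hz : Function.Injective z) {W : Fin n → Fin t → ℂ}
    (hW : ∀ i k, ∑ b, W i b * conj (W k b) = reducedKernel H x₀ (z i) (z k)) :
    ∃ (φ : Fin t → X → ℂ) (T : Fin t → H →L[ℂ] H),
      (∀ b, IsMultiplicationOperator (φ b) (T b)) ∧ (∀ b i, φ b (z i) = W i b) ∧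
      ∀ f : Fin t → H, ‖∑ b, T b (f b)‖ ^ 2 ≤ ∑ b, ‖f b‖ ^ 2 := by
  obtain ⟨Φ, hΦ, hΦW⟩ := hnp 1 t n z (fun i => Matrix.of fun _ b => W i b) hz (by
    -- The Pick matrix is (1 - F)K = K(·, x₀)K(x₀, ·)/K(x₀, x₀), positive of rank one.
    convert Matrix.posSemidef_vecMulVec_self_star
      (fun p : Fin n × Fin 1 => kernel H (z p.1) x₀ / (‖kernelVec H x₀‖ : ℂ)) using 1
    ext p q
    have h1 : (1 : Matrix (Fin 1) (Fin 1) ℂ) p.2 q.2 = 1 := by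
      rw [Subsingleton.elim p.2 q.2, Matrix.one_apply_eq]
    simp only [Matrix.of_apply, Matrix.sub_apply, h1, Matrix.mul_apply,
      Matrix.conjTranspose_apply, Matrix.vecMulVec_apply, Pi.star_apply, RCLike.star_def, hW]
    rw [sub_mul, one_mul, reducedKernel_mul hirr, map_div₀, conj_kernel, Complex.conj_ofReal,
      kernel_self x₀]
    ring)
  have hop : ∀ b, ∃ T : H →L[ℂ] H, IsMultiplicationOperator (fun x => Φ x 0 b) T := by
    intro b
    have h1 : ∀ f : H, ∃ g : H, (∀ x, g x = Φ x 0 b * f x) ∧ ‖g‖ ≤ ‖f‖ := by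
      intro f
      obtain ⟨g, hg, hgn⟩ := hΦ (Pi.single b f)
      refine ⟨g 0, fun x => ?_, ?_⟩
      · rw [hg, Finset.sum_eq_single b]
        · simp
        · intro c _ hc
          simp [hc]
        · simp
      · rw [Fin.sum_univ_one, Finset.sum_eq_single b] at hgn
        · simp only [Pi.single_eq_same] at hgn
          exact (sq_le_sq₀ (norm_nonneg _) (norm_nonneg _)).mp hgn
        · intro c _ hc
          simp [hc]
        · simp
    choose g hg hgn using h1
    refine ⟨LinearMap.mkContinuous ⟨⟨g, fun f₁ f₂ => ?_⟩, fun c f => ?_⟩ 1 fun f => ?_, ?_⟩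
    · ext x
      simp [hg, mul_add]
    · ext x
      simp only [hg, RKHS.coe_smul, Pi.smul_apply, smul_eq_mul, RingHom.id_apply]
      ring
    · simpa using hgn f
    · intro f x
      exact hg f x
  choose T hT using hop
  refine ⟨fun b x => Φ x 0 b, T, hT, fun b i => ?_, fun f => ?_⟩
  · simp [hΦW]
  · obtain ⟨g, hg, hgn⟩ := hΦ f
    have h1 : ∑ b, T b (f b) = g 0 := by
      ext x
      rw [hg, ← RKHS.coeCLM_apply (𝕜 := ℂ), map_sum, Finset.sum_apply]
      exact Finset.sum_congr rfl fun b _ => hT b (f b) x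
    rw [h1]
    simpa using hgn

/-- Existence of extremal functions in the Schwarz lemma. -/
theorem IsCompleteNevanlinnaPick.exists_extremal (hirr : IsIrreducible (X := X) H)
    (hnp : IsCompleteNevanlinnaPick (X := X) H) {x₀ y : X} (hy : y ≠ x₀) :
    ∃ (φ : X → ℂ) (T : H →L[ℂ] H), IsMultiplicationOperator φ T ∧ (∀ f, ‖T f‖ ≤ ‖f‖) ∧
      φ x₀ = 0 ∧ φ y = radius H x₀ y := by
  obtain ⟨φ, T, hT, hφ, hc⟩ := hnp.exists_row hirr x₀ (z := ![x₀, y])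
    (W := ![![0], ![(radius H x₀ y : ℂ)]]) (by
      intro i k
      fin_cases i <;> fin_cases k <;> simp [hy, hy.symm]) (by
      intro i k
      fin_cases i <;> fin_cases k <;>
        simp [reducedKernel_left hirr, reducedKernel_right hirr, reducedKernel_self hirr, sq])
  refine ⟨φ 0, T 0, hT 0, fun f => ?_, by simpa using hφ 0 0, by simpa using hφ 0 1⟩
  exact (sq_le_sq₀ (norm_nonneg _) (norm_nonneg _)).mp (by simpa using hc ![f])

/-- If all multiplication operators are hyponormal, then the Cauchy-Schwarz inequality for the
reduced kernel is an equality. -/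
theorem norm_reducedKernel (hirr : IsIrreducible (X := X) H)
    (hnp : IsCompleteNevanlinnaPick (X := X) H)
    (hhyp : ∀ (φ : X → ℂ) (T : H →L[ℂ] H), IsMultiplicationOperator φ T → IsHyponormal T)
    {x₀ y z : X} (hy : y ≠ x₀) (hz : z ≠ x₀) :
    ‖reducedKernel H x₀ z y‖ = radius H x₀ y * radius H x₀ z := by
  have hry := radius_pos (H := H) hirr hy
  have hrz := radius_pos (H := H) hirr hz
  have hle : ‖reducedKernel H x₀ z y‖ ≤ radius H x₀ y * radius H x₀ z := by
    obtain ⟨φ, T, hT, hc, h0, hφy⟩ := hnp.exists_extremal hirr hy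
    rw [← hT.mul_conj_eq_reducedKernel hirr hc h0 (y := y) (by simp [hφy, hry.le]), norm_mul,
      RCLike.norm_conj, hφy, Complex.norm_real, Real.norm_of_nonneg hry.le, mul_comm]
    gcongr
    exact hT.norm_le_radius hirr hc h0 z
  by_contra hne
  have hlt := lt_of_le_of_ne hle hne
  have hzy : z ≠ y := by
    rintro rfl
    rw [reducedKernel_self hirr] at hne
    simp [sq] at hne
  -- The rows (0, 0), (radius y, 0), (p, s) are a Cholesky factorization of F over x₀, y, z; strict
  -- inequality is what makes s positive.
  set p : ℂ := reducedKernel H x₀ z y / radius H x₀ y with hp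
  have hpn : ‖p‖ < radius H x₀ z := by
    rw [hp, norm_div, Complex.norm_real, Real.norm_of_nonneg hry.le, div_lt_iff₀ hry, mul_comm]
    exact hlt
  have hs : 0 < radius H x₀ z ^ 2 - ‖p‖ ^ 2 := by
    nlinarith [norm_nonneg p]
  set s : ℝ := Real.sqrt (radius H x₀ z ^ 2 - ‖p‖ ^ 2) with hsdef
  have hs2 : s ^ 2 = radius H x₀ z ^ 2 - ‖p‖ ^ 2 := Real.sq_sqrt hs.le
  have hs0 : 0 < s := Real.sqrt_pos.mpr hs
  have hry' : (radius H x₀ y : ℂ) ≠ 0 := by exact_mod_cast hry.ne'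
  have hrz' : (radius H x₀ z : ℂ) ≠ 0 := by exact_mod_cast hrz.ne'
  have hgram : p * conj p + (s : ℂ) * s = (radius H x₀ z : ℂ) ^ 2 := by
    rw [Complex.mul_conj', ← sq]
    exact_mod_cast (by linarith : ‖p‖ ^ 2 + s ^ 2 = radius H x₀ z ^ 2)
  obtain ⟨φ, T, hT, hφ, hc⟩ := hnp.exists_row hirr x₀ (z := ![x₀, y, z])
    (W := ![![0, 0], ![(radius H x₀ y : ℂ), 0], ![p, (s : ℂ)]]) (by
      intro i k
      fin_cases i <;> fin_cases k <;> simp [hy, hy.symm, hz, hz.symm, hzy, hzy.symm]) (by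
      intro i k
      fin_cases i <;> fin_cases k <;>
        simp [reducedKernel_left hirr, reducedKernel_right hirr, reducedKernel_self hirr]
      · ring
      · rw [hp, map_div₀, conj_reducedKernel, Complex.conj_ofReal]
        field_simp
      · rw [hp]
        field_simp
      · exact hgram)
  have hrow : ∀ f g, ‖T 0 f + T 1 g‖ ^ 2 ≤ ‖f‖ ^ 2 + ‖g‖ ^ 2 := fun f g => by
    simpa [Fin.sum_univ_two] using hc ![f, g]
  have hc0 : ∀ f, ‖T 0 f‖ ≤ ‖f‖ := fun f =>
    (sq_le_sq₀ (norm_nonneg _) (norm_nonneg _)).mp (by simpa using hrow f 0)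
  have hc1 : ∀ f, ‖T 1 f‖ ≤ ‖f‖ := fun f =>
    (sq_le_sq₀ (norm_nonneg _) (norm_nonneg _)).mp (by simpa using hrow 0 f)
  have h00 : φ 0 x₀ = 0 := by simpa using hφ 0 0
  have h10 : φ 1 x₀ = 0 := by simpa using hφ 1 0
  have h0y : φ 0 y = radius H x₀ y := by simpa using hφ 0 1
  have h0z : φ 0 z = p := by simpa using hφ 0 2
  have h1z : φ 1 z = s := by simpa using hφ 1 2
  have hT0 := (hT 0).adjoint_apply_kernelVec hirr hc0 (hhyp _ _ (hT 0)) h00 hy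
    (by simp [h0y, hry.le])
  set e := kernelVec H x₀
  have horth : inner ℂ (T 0 e) (T 1 e) = 0 := by
    rw [← ContinuousLinearMap.adjoint_inner_left, adjoint_apply_eq_zero_of_row hrow hT0,
      inner_zero_left]
  -- (a, b) is the unit vector for which aφ₀ + bφ₁ attains the extremal value at z. This combination
  -- is therefore isometric at e, and as T₀ is too, with T₀e ⊥ T₁e and b ≠ 0, so is T₁.
  set a : ℂ := conj p / radius H x₀ z with ha
  set b : ℂ := s / radius H x₀ z with hb
  have hab : ‖a‖ ^ 2 + ‖b‖ ^ 2 = 1 := by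
    rw [ha, hb, norm_div, norm_div, RCLike.norm_conj, Complex.norm_real, Complex.norm_real,
      Real.norm_of_nonneg hrz.le, Real.norm_of_nonneg hs0.le, div_pow, div_pow, hs2]
    field_simp
    ring
  have hb0 : ‖b‖ ≠ 0 := by
    rw [norm_ne_zero_iff, hb]
    exact div_ne_zero (by exact_mod_cast hs0.ne') hrz'
  have hP := ((hT 0).smul a).add ((hT 1).smul b)
  have hPc : ∀ f, ‖(a • T 0 + b • T 1) f‖ ≤ ‖f‖ := fun f => by
    have h := hrow (a • f) (b • f)
    rw [map_smul, map_smul, norm_smul, norm_smul, mul_pow, mul_pow, ← add_mul, hab, one_mul] at h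
    exact (sq_le_sq₀ (norm_nonneg _) (norm_nonneg _)).mp h
  have hPe := norm_apply_of_adjoint_apply_apply <|
    hP.adjoint_apply_kernelVec hirr hPc (hhyp _ _ hP) (x₀ := x₀) (by simp [h00, h10]) hz (by
      have h : (a • φ 0 + b • φ 1) z = radius H x₀ z := by
        simp only [Pi.add_apply, Pi.smul_apply, h0z, h1z, smul_eq_mul, ha, hb]
        field_simp
        linear_combination hgram
      rw [h, Complex.norm_real, Real.norm_of_nonneg hrz.le])
  have hT1e : ‖T 1 e‖ ^ 2 = ‖e‖ ^ 2 := by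
    have h : ‖(a • T 0 + b • T 1) e‖ ^ 2 = ‖e‖ ^ 2 := by rw [hPe]
    simp only [FunLike.coe_add, FunLike.coe_smul, Pi.add_apply, Pi.smul_apply] at h
    rw [norm_add_sq (𝕜 := ℂ), inner_smul_left, inner_smul_right, horth, mul_zero, mul_zero,
      map_zero, norm_smul, norm_smul, mul_pow, mul_pow,
      norm_apply_of_adjoint_apply_apply hT0] at h
    have h' : ‖b‖ ^ 2 * (‖T 1 e‖ ^ 2 - ‖e‖ ^ 2) = 0 := by linear_combination h - ‖e‖ ^ 2 * hab
    exact sub_eq_zero.mp ((mul_eq_zero.mp h').resolve_left (pow_ne_zero 2 hb0))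
  have hpair : IsHyponormalRow (T 0) (T 1) e :=
    { comm := fun f => by
        ext x
        rw [hT 0, hT 1, hT 1, hT 0]
        ring
      left := hhyp _ _ (hT 0)
      right := hhyp _ _ (hT 1)
      row := hrow
      left_apply := hT0
      right_apply := adjoint_apply_apply_eq_self hc1
        ((sq_eq_sq₀ (norm_nonneg _) (norm_nonneg _)).mp hT1e).ge }
  have he := hpair.eq_zero (fun r => hhyp _ _ (((hT 0).add (hT 1)).smul r))
    (fun r => hhyp _ _ (((hT 0).sub (hT 1)).smul r)) (hhyp _ _ ((hT 0).comp (hT 1)))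
  exact (norm_kernelVec_pos hirr x₀).ne' (by simpa using he)

end Pick

/-! ### Identification with the Hardy space. -/

section HardyModel

open scoped InnerProduct

variable {X H : Type*} [NormedAddCommGroup H] [InnerProductSpace ℂ H] [RKHS ℂ H X ℂ]

theorem IsHolomorphicVia.mul {n : ℕ} {e : X → EuclideanSpace ℂ (Fin n)} {f g : X → ℂ}
    (hf : IsHolomorphicVia e f) (hg : IsHolomorphicVia e g) :
    IsHolomorphicVia e fun x => f x * g x := fun x => by
  obtain ⟨U, F, hU, hxU, hF, hFf⟩ := hf x
  obtain ⟨V, G, hV, hxV, hG, hGg⟩ := hg x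
  exact ⟨U ∩ V, fun w => F w * G w, hU.inter hV, ⟨hxU, hxV⟩,
    (hF.mono Set.inter_subset_left).mul (hG.mono Set.inter_subset_right),
    fun y hy => by simp only [hFf y hy.1, hGg y hy.2]⟩

theorem IsHolomorphicVia.inv {n : ℕ} {e : X → EuclideanSpace ℂ (Fin n)} {f : X → ℂ}
    (hf : IsHolomorphicVia e f) (h0 : ∀ x, f x ≠ 0) :
    IsHolomorphicVia e fun x => (f x)⁻¹ := fun x => by
  obtain ⟨U, F, hU, hxU, hF, hFf⟩ := hf x
  refine ⟨U ∩ F ⁻¹' {0}ᶜ, fun w => (F w)⁻¹,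
    hF.continuousOn.isOpen_inter_preimage hU isOpen_compl_singleton,
    ⟨hxU, by simp [hFf x hxU, h0 x]⟩,
    (hF.mono Set.inter_subset_left).inv fun w hw => hw.2, fun y hy => by simp only [hFf y hy.1]⟩

theorem IsHolomorphicVia.const_sub_mul {n : ℕ} {e : X → EuclideanSpace ℂ (Fin n)} {f : X → ℂ}
    (hf : IsHolomorphicVia e f) (a b : ℂ) : IsHolomorphicVia e fun x => a - b * f x := fun x => by
  obtain ⟨U, F, hU, hxU, hF, hFf⟩ := hf x
  exact ⟨U, fun w => a - b * F w, hU, hxU, (hF.const_mul b).const_sub a,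
    fun y hy => by simp only [hFf y hy]⟩

/-- An f that vanishes on the range of j is sent to 0 by the injective map U. -/
theorem isUniquenessSet_range {j : X → 𝔻} {δ : X → ℂ} {U : Hardy ≃ₗᵢ[ℂ] H}
    (hU : ∀ f x, U f x = δ x * f (j x)) : IsUniquenessSet (Set.range j) := by
  intro f hf
  refine (map_eq_zero_iff U U.injective).mp (RKHS.ext (𝕜 := ℂ) fun x => ?_)
  rw [hU, hf _ ⟨x, rfl⟩]
  simp

/-- A complete orthonormal sequence gives an isometric equivalence from the Hardy space. -/
theorem exists_hardy_equiv_of_orthonormal [CompleteSpace H] {v : ℕ → H} (hv : Orthonormal ℂ v)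
    (hd : ∀ f : H, (∀ g ∈ (Submodule.span ℂ (Set.range v)).topologicalClosure, inner ℂ g f = 0) →
      f = 0) :
    ∃ U : Hardy ≃ₗᵢ[ℂ] H, ∀ f, HasSum (fun n => f.coeff n • v n) (U f) := by
  have hbot : (Submodule.span ℂ (Set.range v))ᗮ = ⊥ := by
    rw [Submodule.eq_bot_iff]
    intro f hf
    refine hd f fun g hg => ?_
    rw [← Submodule.orthogonal_closure] at hf
    exact hf g hg
  let b := HilbertBasis.mkOfOrthogonalEqBot hv hbot
  refine ⟨b.repr.symm, fun f => ?_⟩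
  have h := b.hasSum_repr_symm f
  simp only [b, HilbertBasis.coe_mkOfOrthogonalEqBot] at h
  exact h

variable [CompleteSpace H]

/-- T* undoes T along the orbit of e, so inner products depend only on the difference of exponents;
those of e with higher powers vanish because φ(x₀) = 0. -/
theorem IsMultiplicationOperator.orthonormal_pow (hirr : IsIrreducible (X := X) H)
    {φ : X → ℂ} {T : H →L[ℂ] H} (hT : IsMultiplicationOperator φ T) (hc : ∀ f, ‖T f‖ ≤ ‖f‖)
    (hhyp : IsHyponormal T) {x₀ : X} (h0 : φ x₀ = 0)
    (hk : (T†) (T (kernelVec H x₀)) = kernelVec H x₀) :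
    Orthonormal ℂ fun n : ℕ => (T ^ n) ((‖kernelVec H x₀‖ : ℂ)⁻¹ • kernelVec H x₀) := by
  set e := (‖kernelVec H x₀‖ : ℂ)⁻¹ • kernelVec H x₀ with he
  have hpos := norm_kernelVec_pos hirr x₀
  have hTe : (T†) (T e) = e := by rw [he, map_smul, map_smul, hk]
  have hen : ‖e‖ = 1 := by
    rw [he, norm_smul, norm_inv, Complex.norm_real, norm_norm, inv_mul_cancel₀ hpos.ne']
  have hzero : ∀ n : ℕ, inner ℂ e ((T ^ (n + 1)) e) = 0 := fun n => by
    rw [he, inner_smul_left, inner_kernelVec_left, hT.pow_apply, h0]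
    simp
  have hshift : ∀ m n : ℕ, inner ℂ ((T ^ (m + 1)) e) ((T ^ (n + 1)) e) =
      inner ℂ ((T ^ m) e) ((T ^ n) e) := fun m n => by
    rw [← hhyp.adjoint_apply_pow hc hTe m, ContinuousLinearMap.adjoint_inner_left, pow_succ' T n,
      mul_apply_eq_comp]
  rw [orthonormal_iff_ite]
  intro m
  induction m with
  | zero =>
    rintro (_ | n)
    · simp [inner_self_eq_norm_sq_to_K, hen]
    · simpa using hzero n
  | succ m ih =>
    rintro (_ | n)
    · rw [← inner_conj_symm, pow_zero, one_apply_eq_self, hzero]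
      simp
    · rw [hshift, ih n]
      simp

/-- If the reduced kernel factors through an isometric multiplication operator, then the space is
a copy of the Hardy space. -/
theorem exists_hardy_equiv (hirr : IsIrreducible (X := X) H) {x₀ : X} {j : X → 𝔻} {T : H →L[ℂ] H}
    (hT : IsMultiplicationOperator (fun x => (j x : ℂ)) T) (hc : ∀ f, ‖T f‖ ≤ ‖f‖)
    (hhyp : IsHyponormal T) (h0 : (j x₀ : ℂ) = 0)
    (hk : (T†) (T (kernelVec H x₀)) = kernelVec H x₀)
    (hK : ∀ x y, kernel H x y = (kernel H x x₀ / ‖kernelVec H x₀‖) *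
      conj (kernel H y x₀ / ‖kernelVec H x₀‖) * (1 - (j x : ℂ) * conj (j y : ℂ))⁻¹) :
    ∃ U : Hardy ≃ₗᵢ[ℂ] H, ∀ f x, U f x = (kernel H x x₀ / ‖kernelVec H x₀‖) * f (j x) := by
  have hv := hT.orthonormal_pow hirr hc hhyp h0 hk
  set v : ℕ → H := fun n => (T ^ n) ((‖kernelVec H x₀‖ : ℂ)⁻¹ • kernelVec H x₀) with hvdef
  have hvx : ∀ n x, v n x = (kernel H x x₀ / ‖kernelVec H x₀‖) * (j x : ℂ) ^ n := fun n x => by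
    simp only [hvdef, hT.pow_apply, RKHS.coe_smul, Pi.smul_apply, kernelVec_apply, smul_eq_mul]
    ring
  have hsum : ∀ y, HasSum (fun n => (conj (kernel H y x₀ / ‖kernelVec H x₀‖) *
      conj (j y : ℂ) ^ n) • v n) (kernelVec H y) := fun y => by
    have hs : Summable fun n => (conj (kernel H y x₀ / ‖kernelVec H x₀‖) *
        conj (j y : ℂ) ^ n) • v n := by
      refine Summable.of_norm ?_
      have h1 : Summable fun n => ‖kernel H y x₀ / ‖kernelVec H x₀‖‖ * ‖(j y : ℂ)‖ ^ n :=
        (summable_geometric_of_lt_one (norm_nonneg _) (j y).norm_lt_one).mul_left _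
      refine h1.congr fun n => ?_
      rw [norm_smul, norm_mul, norm_pow, RCLike.norm_conj, RCLike.norm_conj, hv.1 n, mul_one]
    -- At each point x the series becomes the geometric expansion of K(x, y).
    convert hs.hasSum using 1
    ext x
    have h1 := (hs.hasSum.mapL (innerSL ℂ (kernelVec H x)))
    simp only [innerSL_apply_apply, inner_kernelVec_left, RKHS.coe_smul, Pi.smul_apply, hvx,
      smul_eq_mul] at h1
    have h2 : ‖(j x : ℂ) * conj (j y : ℂ)‖ < 1 := by
      rw [norm_mul, RCLike.norm_conj]
      nlinarith [(j x).norm_lt_one, (j y).norm_lt_one, norm_nonneg (j x : ℂ),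
        norm_nonneg (j y : ℂ)]
    have h3 := (hasSum_geometric_of_norm_lt_one h2).mul_left
      ((kernel H x x₀ / ‖kernelVec H x₀‖) * conj (kernel H y x₀ / ‖kernelVec H x₀‖))
    rw [kernelVec_apply, hK, ← h3.tsum_eq, ← h1.tsum_eq]
    refine tsum_congr fun n => ?_
    ring
  -- Every kernel function lies in the closed span of the sequence, so a vector orthogonal to it
  -- vanishes at every point.
  obtain ⟨U, hU⟩ := exists_hardy_equiv_of_orthonormal hv fun f hf => by
    ext x
    rw [← inner_kernelVec_left, hf, RKHS.coe_zero, Pi.zero_apply]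
    refine mem_closure_of_tendsto (hsum x) (Filter.Eventually.of_forall fun s => ?_)
    exact Submodule.sum_mem _ fun n _ => Submodule.smul_mem _ _ (Submodule.subset_span ⟨n, rfl⟩)
  refine ⟨U, fun f x => ?_⟩
  have h1 := (hU f).mapL (innerSL ℂ (kernelVec H x))
  simp only [innerSL_apply_apply, inner_kernelVec_left, RKHS.coe_smul, Pi.smul_apply, hvx,
    smul_eq_mul] at h1
  have h2 := (f.hasSum_eval (j x)).mul_left (kernel H x x₀ / ‖kernelVec H x₀‖)
  simp only [mul_left_comm _ (f.coeff _)] at h2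
  exact h1.unique h2

/-- Hyponormality of all multiplication operators forces the reduced kernel to have rank one. -/
theorem exists_rank_one (hirr : IsIrreducible (X := X) H)
    (hnp : IsCompleteNevanlinnaPick (X := X) H)
    (hhyp : ∀ (φ : X → ℂ) (T : H →L[ℂ] H), IsMultiplicationOperator φ T → IsHyponormal T)
    {x₀ y : X} (hy : y ≠ x₀) :
    ∃ (j : X → 𝔻) (T : H →L[ℂ] H), IsMultiplicationOperator (fun x => (j x : ℂ)) T ∧
      (∀ f, ‖T f‖ ≤ ‖f‖) ∧ (j x₀ : ℂ) = 0 ∧ (T†) (T (kernelVec H x₀)) = kernelVec H x₀ ∧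
      (∀ x z, (j x : ℂ) * conj (j z : ℂ) = reducedKernel H x₀ x z) ∧
      ∀ x, (j x : ℂ) = reducedKernel H x₀ x y / radius H x₀ y := by
  obtain ⟨φ, T, hT, hc, h0, hφy⟩ := hnp.exists_extremal hirr hy
  have hr := radius_pos (H := H) hirr hy
  have hr' : (radius H x₀ y : ℂ) ≠ 0 := by exact_mod_cast hr.ne'
  have hyn : ‖φ y‖ = radius H x₀ y := by rw [hφy, Complex.norm_real, Real.norm_of_nonneg hr.le]
  have hφ : ∀ x, φ x = reducedKernel H x₀ x y / radius H x₀ y := fun x => by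
    rw [eq_div_iff hr', ← hT.mul_conj_eq_reducedKernel hirr hc h0 hyn, hφy, Complex.conj_ofReal]
  -- Equality in Cauchy–Schwarz makes φ extremal at every x ≠ x₀, not only at y, so uniqueness of
  -- extremals applies with any z in place of y.
  have hφn : ∀ x, x ≠ x₀ → ‖φ x‖ = radius H x₀ x := fun x hx => by
    rw [hφ, norm_div, norm_reducedKernel hirr hnp hhyp hy hx, Complex.norm_real,
      Real.norm_of_nonneg hr.le, mul_div_cancel_left₀ _ hr.ne']
  have hlt : ∀ x, ‖φ x‖ < 1 := fun x =>
    (hT.norm_le_radius hirr hc h0 x).trans_lt (radius_lt_one hirr x₀ x)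
  refine ⟨fun x => Complex.UnitDisc.mk (φ x) (hlt x), T, hT, hc, h0,
    hT.adjoint_apply_kernelVec hirr hc (hhyp _ _ hT) h0 hy hyn, fun x z => ?_, hφ⟩
  simp only [Complex.UnitDisc.coe_mk]
  rcases eq_or_ne z x₀ with rfl | hz
  · rw [h0, map_zero, mul_zero, reducedKernel_right hirr]
  · exact hT.mul_conj_eq_reducedKernel hirr hc h0 (hφn z hz) x

/-- Points with the same image under j have proportional kernel functions, against irreducibility.
-/
theorem injective_of_kernel_eq (hirr : IsIrreducible (X := X) H) {j : X → 𝔻} {δ : X → ℂ}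
    (hδ : ∀ x, δ x ≠ 0)
    (hK : ∀ x y, kernel H x y = δ x * conj (δ y) * (1 - (j x : ℂ) * conj (j y : ℂ))⁻¹) :
    Function.Injective j := by
  intro x y hxy
  by_contra hne
  have h := LinearIndependent.pair_iff.mp (hirr.2 x y hne) (conj (δ y)) (-conj (δ x)) <| by
    funext u
    simp only [Pi.add_apply, Pi.smul_apply, smul_eq_mul, Pi.zero_apply, hK u, hxy]
    ring
  exact hδ y (by simpa using h.1)

theorem bijective_eval_of_forall_eq (hirr : IsIrreducible (X := X) H) {x₀ : X}
    (hx : ∀ x, x = x₀) : Function.Bijective fun f : H => f x₀ := by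
  refine ⟨fun f g hfg => RKHS.ext (𝕜 := ℂ) fun x => hx x ▸ hfg, fun c => ?_⟩
  refine ⟨(c / kernel H x₀ x₀) • kernelVec H x₀, ?_⟩
  simp only [RKHS.coe_smul, Pi.smul_apply, kernelVec_apply, smul_eq_mul]
  exact div_mul_cancel₀ _ (hirr.1 _ _)

end HardyModel

end HilbertFunctionSpace

/-! ### The main theorem. -/

open HilbertFunctionSpace in
theorem theorem1 {X : Type*} [Nonempty X] {H : Type*} [NormedAddCommGroup H]
    [InnerProductSpace ℂ H] [CompleteSpace H] [RKHS ℂ H X ℂ]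
    (hirr : HilbertFunctionSpace.IsIrreducible H)
    (hnp : HilbertFunctionSpace.IsCompleteNevanlinnaPick H)
    (hhyp : ∀ (φ : X → ℂ) (T : H →L[ℂ] H),
      HilbertFunctionSpace.IsMultiplicationOperator φ T → HilbertFunctionSpace.IsHyponormal T) :
    (∃ x₀ : X, (∀ x, x = x₀) ∧ Function.Bijective fun f : H => f x₀) ∨
    ∃ (A : Set 𝔻) (j : X → 𝔻) (δ : X → ℂ),
      HilbertFunctionSpace.IsUniquenessSet A ∧
      Set.BijOn j Set.univ A ∧
      (∀ x, δ x ≠ 0) ∧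
      (∀ x y : X, HilbertFunctionSpace.kernel H x y =
        δ x * conj (δ y) * (1 - (j x : ℂ) * conj (j y : ℂ))⁻¹) ∧
      (∃ U : HilbertFunctionSpace.Hardy ≃ₗᵢ[ℂ] H, ∀ f x, U f x = δ x * f (j x)) ∧
      (∀ [TopologicalSpace X],
        (∀ y, Continuous fun x => HilbertFunctionSpace.kernel H x y) →
        (∀ x, Continuous fun y => HilbertFunctionSpace.kernel H x y) →
        Continuous j) ∧
      (∀ (n : ℕ) (e : X → EuclideanSpace ℂ (Fin n)), Function.Injective e →
        (∀ y, HilbertFunctionSpace.IsHolomorphicVia e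
          fun x => HilbertFunctionSpace.kernel H x y) →
        HilbertFunctionSpace.IsHolomorphicVia e fun x => (j x : ℂ)) := by
  obtain ⟨x₀⟩ := ‹Nonempty X›
  by_cases hx : ∀ x, x = x₀
  · exact Or.inl ⟨x₀, hx, bijective_eval_of_forall_eq hirr hx⟩
  right
  push Not at hx
  obtain ⟨y₀, hy₀⟩ := hx
  obtain ⟨j, T, hT, hc, h0, hk, hj, hjy⟩ := exists_rank_one hirr hnp hhyp hy₀
  have hpos := norm_kernelVec_pos hirr x₀
  have hne : (‖kernelVec H x₀‖ : ℂ) ≠ 0 := by exact_mod_cast hpos.ne'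
  have hδ : ∀ x, kernel H x x₀ / ‖kernelVec H x₀‖ ≠ 0 := fun x => div_ne_zero (hirr.1 _ _) hne
  have hK : ∀ x y, kernel H x y = (kernel H x x₀ / ‖kernelVec H x₀‖) *
      conj (kernel H y x₀ / ‖kernelVec H x₀‖) * (1 - (j x : ℂ) * conj (j y : ℂ))⁻¹ := fun x y => by
    have h1 := hirr.1 x y
    have h2 := hirr.1 x x₀
    have h3 := hirr.1 x₀ y
    rw [hj, reducedKernel, kernel_self, map_div₀, conj_kernel, Complex.conj_ofReal, sub_sub_cancel]
    field_simp
  obtain ⟨U, hU⟩ := exists_hardy_equiv hirr hT hc (hhyp _ _ hT) h0 hk hK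
  -- j is an affine function of the quotient K(·, x₀)/K(·, y₀), so it inherits continuity and
  -- holomorphy from the kernel.
  have hjy' : ∀ x, (j x : ℂ) = (radius H x₀ y₀ : ℂ)⁻¹ -
      (radius H x₀ y₀ : ℂ)⁻¹ * (kernel H x₀ y₀ / kernel H x₀ x₀) *
        (kernel H x x₀ * (kernel H x y₀)⁻¹) := fun x => by
    rw [hjy, reducedKernel]
    have h1 := hirr.1 x y₀
    have h2 := hirr.1 x₀ x₀
    field_simp
  refine ⟨Set.range j, j, _, isUniquenessSet_range hU, ?_, hδ, hK, ⟨U, hU⟩, ?_, ?_⟩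
  · rw [← Set.image_univ]
    exact (injective_of_kernel_eq hirr hδ hK).injOn.bijOn_image
  · intro _ h1 _
    rw [Complex.UnitDisc.isEmbedding_coe.continuous_iff]
    refine (continuous_const.sub (continuous_const.mul
      ((h1 x₀).mul ((h1 y₀).inv₀ fun x => hirr.1 x y₀)))).congr fun x => (hjy' x).symm
  · intro n e _ h1
    simp only [hjy']
    exact ((h1 x₀).mul ((h1 y₀).inv fun x => hirr.1 x y₀)).const_sub_mul _ _
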